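/- Let $\Lambda^*\subset\mathbb{C}$ be a domain (a non-empty connected open set), let $\lambda^*\in\mathbb{C}$ be an isolated point of the boundary of $\Lambda^*$, and put $\Lambda=\Lambda^*\cup\{\lambda^*\}$. Let $E\subset\mathbb{C}$ be connected and let $H:\Lambda^*\times E\to\mathbb{C}$ be a holomorphic motion over $\Lambda^*$ with base point $\lambda_0\in\Lambda^*$; that is, $H(\lambda_0,z)=z$ for all $z\in E$, the map $H_\lambda=H(\lambda,\cdot)$ is injective on $E$ for every $\lambda\in\Lambda^*$, and $H^z=H(\cdot,z)$ is holomorphic on $\Lambda^*$ for every $z\in E$. Suppose that there are two distinct points $z_0,z_1\in E$ such that $H^{z_0}$ and $H^{z_1}$ extend holomorphically to $\Lambda$. For $\lambda\in\Lambda^*$ and $z\in E$ put $$\widetilde H(\lambda,z)=z_0+(z_1-z_0)\,\frac{H(\lambda,z)-H(\lambda,z_0)}{H(\lambda,z_1)-H(\lambda,z_0)}.$$ Then for every $z\in E$ both $H^z$ and $\widetilde H^z$ extend holomorphically to $\Lambda$, and the maps $H,\widetilde H:\Lambda\times E\to\mathbb{C}$ so extended have the following properties. The map $\widetilde H$ is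 a holomorphic motion of $E$ over $\Lambda$ with base point $\lambda_0$ (in particular $\widetilde H_{\lambda^*}$ is injective on $E$), and $\widetilde H(\lambda,z_0)=z_0$, $\widetilde H(\lambda,z_1)=z_1$ for all $\lambda\in\Lambda$. Moreover, there exist holomorphic functions $f,g:\Lambda\to\mathbb{C}$ with $f(\lambda_0)=0$, $g(\lambda_0)=1$ and $g(\lambda)\neq 0$ for all $\lambda\in\Lambda^*$, such that $$H(\lambda,z)=f(\lambda)+g(\lambda)\cdot\widetilde H(\lambda,z)\qquad\text{for all }\lambda\in\Lambda,\ z\in E.$$ -/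

import Mathlib

open Set Filter Topology

/-- `H` is a holomorphic motion in `ℂ` of `E`, parametrized by the domain `D ⊆ ℂ`, with base
point `p ∈ D`. Only the values of `H` on `D × E` matter. -/
structure IsHolomorphicMotion (D E : Set ℂ) (p : ℂ) (H : ℂ → ℂ → ℂ) : Prop where
  isOpen : IsOpen D
  isConnected : IsConnected D
  base_mem : p ∈ D
  map_base : ∀ z ∈ E, H p z = z
  vertically_injective : ∀ l ∈ D, InjOn (H l) E
  horizontally_holomorphic : ∀ z ∈ E, DifferentiableOn ℂ (fun l => H l z) D

/-- `q` is an isolated point of the boundary of `D`. -/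
def IsIsolatedBoundaryPoint (D : Set ℂ) (q : ℂ) : Prop :=
  q ∈ frontier D ∧ ∀ᶠ w in 𝓝[≠] q, w ∉ frontier D

/-- The holomorphic function `F` on `D'` extends the function `h` on `D`. -/
def IsHolomorphicExtension (D D' : Set ℂ) (h F : ℂ → ℂ) : Prop :=
  DifferentiableOn ℂ F D' ∧ EqOn F h D

/-- `K` extends `H : D × E → ℂ` horizontally holomorphically to `D' × E`. -/
def IsHorizontalExtension (D D' E : Set ℂ) (H K : ℂ → ℂ → ℂ) : Prop :=
  ∀ z ∈ E, IsHolomorphicExtension D D' (fun l => H l z) (fun l => K l z)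

/-- The normalized map
`(l, z) ↦ z₀ + (z₁ - z₀) (H(l, z) - H(l, z₀)) / (H(l, z₁) - H(l, z₀))`. -/
noncomputable def normalizedMotion (H : ℂ → ℂ → ℂ) (z₀ z₁ : ℂ) : ℂ → ℂ → ℂ :=
  fun l z => z₀ + (z₁ - z₀) * ((H l z - H l z₀) / (H l z₁ - H l z₀))

/-! After normalization the trajectories of `z₀` and `z₁` are constant, so every other trajectory
omits two values near the puncture `q` and is meromorphic there by the great Picard theorem. It
remains to exclude poles and collisions at `q`; both follow once every difference of two
trajectories has order 0 at `q`.

The order of `K z - K b` at `q` is locally constant in `z ∈ E` away from `b`. Indeed, as `z → a` in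
`E`, the quotients `(K z - K a) / (K b - K a)` omit 0 and 1 and tend to 0 at the base point, hence
locally uniformly (Schottky plus Harnack). On a circle around `q` the zero-free function `(K z - K
b) / (K a - K b)` is therefore close to 1, and the maximum principle forces its order at `q` to be 0
(`eventually_meromorphicOrderAt_sub_eq`). Connectedness of `E` and the ultrametric inequality then
make all differences have the same order (`meromorphicOrderAt_sub_eq`), namely that of the constant
`z₁ - z₀`.

The given extensions of the two trajectories supply `f` and `g`, and `f + g * Htilde` extends `H`.
Schottky's theorem is derived from Bloch's by writing a function that omits 0 and 1 through two
nested cosines. -/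

/-! ### Bloch's theorem and functions whose image contains no large disc -/

open Metric in
/-- **Bloch's theorem**, with a non-optimal constant. -/
theorem exists_ball_subset_image_of_differentiableOn {f : ℂ → ℂ} {c : ℂ} {R : ℝ} (hR : 0 < R)
    (hf : DifferentiableOn ℂ f (ball c R)) :
    ∃ w, ball w (‖deriv f c‖ * R / 96) ⊆ f '' ball c R := by
  rcases eq_or_ne (deriv f c) 0 with h0 | h0
  · exact ⟨0, by simp [h0]⟩
  have hf' : DifferentiableOn ℂ (deriv f) (ball c R) := hf.deriv isOpen_ball
  have hsub : closedBall c (R / 2) ⊆ ball c R := closedBall_subset_ball (by linarith)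
  -- Recentring at a maximum of this weighted derivative keeps `‖deriv f‖` at most twice its central
  -- value on the disc of radius `t`, half the distance from `a` to the boundary circle.
  obtain ⟨a, ha, hmax⟩ := (isCompact_closedBall c (R / 2)).exists_isMaxOn
    ⟨c, mem_closedBall_self (by positivity)⟩
    (f := fun z => ‖deriv f z‖ * (R / 2 - ‖z - c‖))
    (((hf'.continuousOn.mono hsub).norm).mul (by fun_prop))
  have hac : ‖a - c‖ ≤ R / 2 := by simpa [dist_eq_norm] using ha
  have h1 : ‖deriv f c‖ * (R / 2) ≤ ‖deriv f a‖ * (R / 2 - ‖a - c‖) := by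
    simpa using hmax (mem_closedBall_self (by positivity) : c ∈ closedBall c (R / 2))
  have hc0 : 0 < ‖deriv f c‖ := norm_pos_iff.2 h0
  obtain ⟨t, ht⟩ : ∃ t, t = (R / 2 - ‖a - c‖) / 2 := ⟨_, rfl⟩
  obtain ⟨m, hm⟩ : ∃ m, m = ‖deriv f a‖ := ⟨_, rfl⟩
  have hm0 : 0 ≤ m := hm ▸ norm_nonneg _
  have hmt : ‖deriv f c‖ * R / 4 ≤ m * t := by rw [ht, hm]; linarith
  have hmtpos : 0 < m * t := lt_of_lt_of_le (by positivity) hmt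
  have htpos : 0 < t := by
    by_contra h
    nlinarith
  have hmpos : 0 < m := by
    by_contra h
    nlinarith
  have hballs : ball a t ⊆ closedBall c (R / 2) := by
    intro z hz
    rw [mem_ball, dist_eq_norm] at hz
    rw [mem_closedBall, dist_eq_norm]
    have := norm_sub_le_norm_sub_add_norm_sub z a c
    linarith
  have hball' : ball a t ⊆ ball c R := hballs.trans hsub
  have h2 : ∀ z ∈ ball a t, ‖deriv f z‖ ≤ 2 * m := by
    intro z hz
    have h3 : ‖deriv f z‖ * (R / 2 - ‖z - c‖) ≤ ‖deriv f a‖ * (R / 2 - ‖a - c‖) :=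
      hmax (hballs hz)
    rw [mem_ball, dist_eq_norm] at hz
    have h4 := norm_sub_le_norm_sub_add_norm_sub z a c
    have h5 : ‖deriv f z‖ * t ≤ ‖deriv f z‖ * (R / 2 - ‖z - c‖) := by
      gcongr; linarith
    have h6 : ‖deriv f z‖ * t ≤ (2 * m) * t := by
      rw [← hm] at h3
      have : R / 2 - ‖a - c‖ = 2 * t := by rw [ht]; ring
      rw [this] at h3
      linarith
    exact le_of_mul_le_mul_right h6 htpos
  -- Schwarz lemma for `deriv f`, whose distance from its value at `a` is at most `2m + m`.
  have h3 : ∀ z ∈ ball a t, ‖deriv f z - deriv f a‖ ≤ 3 * m / t * ‖z - a‖ := by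
    intro z hz
    have := Complex.dist_le_div_mul_dist_of_mapsTo_ball (R₂ := 3 * m) (hf'.mono hball')
      (fun w hw => by
        rw [mem_closedBall, dist_eq_norm]
        have := norm_sub_le (deriv f w) (deriv f a)
        linarith [h2 w hw]) hz
    simpa [dist_eq_norm] using this
  have hs : closedBall a (t / 6) ⊆ ball a t := closedBall_subset_ball (by linarith)
  have h4 : ∀ z ∈ closedBall a (t / 6),
      ‖f z - f a - deriv f a * (z - a)‖ ≤ m / 2 * ‖z - a‖ := by
    intro z hz
    have := (convex_closedBall a (t / 6)).norm_image_sub_le_of_norm_hasDerivWithin_le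
      (f := fun w => f w - deriv f a * (w - a)) (f' := fun w => deriv f w - deriv f a)
      (C := m / 2) (x := a) (y := z) (fun w hw => ?_) (fun w hw => ?_)
      (mem_closedBall_self (by positivity)) hz
    · simpa [sub_right_comm] using this
    · have hd := (hf.differentiableAt (isOpen_ball.mem_nhds (hball' (hs hw)))).hasDerivAt
      have := hd.sub (((hasDerivAt_id w).sub_const a).const_mul (deriv f a))
      exact HasDerivAt.hasDerivWithinAt (by simpa [Pi.sub_def] using this)
    · refine (h3 w (hs hw)).trans ?_
      rw [mem_closedBall, dist_eq_norm] at hw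
      calc 3 * m / t * ‖w - a‖ ≤ 3 * m / t * (t / 6) := by gcongr
        _ = m / 2 := by field_simp; norm_num
  have h5 : ∀ z ∈ sphere a (t / 6), m * t / 12 ≤ ‖f z - f a‖ := by
    intro z hz
    have h6 := h4 z (sphere_subset_closedBall hz)
    rw [mem_sphere, dist_eq_norm] at hz
    have h7 := norm_sub_norm_le (deriv f a * (z - a)) (f z - f a)
    rw [norm_sub_rev (deriv f a * (z - a)), norm_mul, ← hm, hz] at h7
    rw [hz] at h6
    linarith
  have ha' : a ∈ ball c R := hsub ha
  have hda : HasDerivAt f (deriv f a) a :=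
    (hf.differentiableAt (isOpen_ball.mem_nhds ha')).hasDerivAt
  have hfreq : ∃ᶠ z in 𝓝 a, f z ≠ f a := by
    have h8 := hda.eventually_ne (c := f a) (by rw [← norm_pos_iff, ← hm]; exact hmpos)
    exact h8.frequently.filter_mono nhdsWithin_le_nhds
  have h9 := DiffContOnCl.ball_subset_image_closedBall
    ((hf.mono (hs.trans hball')).diffContOnCl_ball subset_rfl)
    (by positivity : 0 < t / 6) h5 hfreq
  -- The covered radius is half of `m * t / 12`, and `m * t ≥ ‖deriv f c‖ * R / 4`, whence 96 = 24 ·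
  -- 4.
  refine ⟨f a, (ball_subset_ball ?_).trans (h9.trans (image_mono (hs.trans hball')))⟩
  linarith

open Metric in
theorem norm_deriv_le_of_forall_exists_notMem_image {f : ℂ → ℂ} {c : ℂ} {R r : ℝ} (hR : 0 < R)
    (hf : DifferentiableOn ℂ f (ball c R)) (h : ∀ w, ∃ p ∈ ball w r, p ∉ f '' ball c R) :
    ‖deriv f c‖ ≤ 96 * r / R := by
  obtain ⟨w, hw⟩ := exists_ball_subset_image_of_differentiableOn hR hf
  obtain ⟨p, hp, hpn⟩ := h w
  rw [le_div_iff₀ hR]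
  by_contra! hlt
  exact hpn (hw (ball_subset_ball (by linarith) hp))

open Metric in
theorem norm_sub_le_of_forall_exists_notMem_image {f : ℂ → ℂ} {c z : ℂ} {R r : ℝ}
    (hf : DifferentiableOn ℂ f (ball c R)) (h : ∀ w, ∃ p ∈ ball w r, p ∉ f '' ball c R)
    (hz : z ∈ ball c (R / 2)) : ‖f z - f c‖ ≤ 96 * r := by
  have hR2 : 0 < R / 2 := pos_of_mem_ball hz
  have hR : 0 < R := by linarith
  have hr : 0 < r := by
    obtain ⟨p, hp, -⟩ := h 0
    exact pos_of_mem_ball hp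
  have key : ∀ w ∈ ball c (R / 2), ‖deriv f w‖ ≤ 96 * r / (R / 2) := by
    intro w hw
    have hsub : ball w (R / 2) ⊆ ball c R := ball_subset_ball' (by rw [mem_ball] at hw; linarith)
    refine norm_deriv_le_of_forall_exists_notMem_image hR2 (hf.mono hsub) fun v => ?_
    obtain ⟨p, hp, hpn⟩ := h v
    exact ⟨p, hp, fun hp' => hpn (image_mono hsub hp')⟩
  have h1 := (convex_ball c (R / 2)).norm_image_sub_le_of_norm_deriv_le
    (fun w hw => hf.differentiableAt (isOpen_ball.mem_nhds
      (ball_subset_ball (by linarith) hw))) key (mem_ball_self hR2) hz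
  rw [mem_ball, dist_eq_norm] at hz
  calc _ ≤ _ := h1
    _ ≤ 96 * r / (R / 2) * (R / 2) := by gcongr
    _ = 96 * r := by field_simp

/-! ### Logarithms and inverse cosines on discs -/

open Metric in
theorem DifferentiableOn.exists_exp_eq_on_ball {f : ℂ → ℂ} {c : ℂ} {R : ℝ}
    (hf : DifferentiableOn ℂ f (ball c R)) (h0 : ∀ z ∈ ball c R, f z ≠ 0) :
    ∃ g : ℂ → ℂ, DifferentiableOn ℂ g (ball c R) ∧ ∀ z ∈ ball c R, Complex.exp (g z) = f z := by
  rcases le_or_gt R 0 with hR | hR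
  · exact ⟨0, by simp [ball_eq_empty.2 hR], by simp [ball_eq_empty.2 hR]⟩
  have hc : c ∈ ball c R := mem_ball_self hR
  obtain ⟨g, hgc, hg⟩ := ((hf.deriv isOpen_ball).div hf h0).isExactOn_ball.with_val_at c
    (Complex.log (f c))
  refine ⟨g, fun z hz => (hg z hz).differentiableAt.differentiableWithinAt, fun z hz => ?_⟩
  have key : ∀ w ∈ ball c R, HasDerivAt (fun w => f w * Complex.exp (-g w)) 0 w := by
    intro w hw
    have h1 := (hf.differentiableAt (isOpen_ball.mem_nhds hw)).hasDerivAt.mul (hg w hw).neg.cexp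
    convert! h1 using 1
    have := h0 w hw
    simp only [Pi.div_apply, Pi.neg_apply]
    field_simp
    ring
  have h2 : f z * Complex.exp (-g z) = f c * Complex.exp (-g c) :=
    isOpen_ball.is_const_of_deriv_eq_zero (convex_ball c R).isPreconnected
      (fun w hw => (key w hw).differentiableAt.differentiableWithinAt)
      (fun w hw => (key w hw).deriv) hz hc
  rw [hgc, Complex.exp_neg, Complex.exp_neg, Complex.exp_log (h0 c hc),
    mul_inv_cancel₀ (h0 c hc)] at h2
  exact (mul_inv_eq_one₀ (Complex.exp_ne_zero _)).1 h2 |>.symm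

theorem Complex.cos_intCast_mul_pi (n : ℤ) : Complex.cos (n * Real.pi) = (-1) ^ n := by
  have h := congrArg ((↑) : ℝ → ℂ) (Real.cos_int_mul_pi n)
  simpa using h

theorem abs_im_le_norm_cos (z : ℂ) : |z.im| ≤ ‖Complex.cos z‖ := by
  have h1 : ‖Complex.cos z‖ ^ 2 = Real.cos z.re ^ 2 + Real.sinh z.im ^ 2 := by
    rw [← Complex.normSq_eq_norm_sq, Complex.normSq_apply]
    conv_lhs => rw [← Complex.re_add_im z, Complex.cos_add_mul_I]
    rw [← Complex.ofReal_cos, ← Complex.ofReal_sin, ← Complex.ofReal_cosh, ← Complex.ofReal_sinh]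
    simp only [Complex.sub_re, Complex.mul_re, Complex.ofReal_re, Complex.ofReal_im, mul_zero,
      sub_zero, Complex.I_re, Complex.mul_im, zero_mul, Complex.I_im, mul_one, Complex.sub_im,
      add_zero, zero_sub]
    linear_combination Real.cos z.re ^ 2 * Real.cosh_sq z.im +
      Real.sinh z.im ^ 2 * Real.sin_sq_add_cos_sq z.re
  have h2 : |z.im| ≤ |Real.sinh z.im| := by
    rw [Real.abs_sinh]
    exact Real.self_le_sinh_iff.2 (abs_nonneg _)
  refine h2.trans (abs_le_of_sq_le_sq ?_ (norm_nonneg _))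
  rw [h1]
  nlinarith [sq_nonneg (Real.cos z.re)]

theorem norm_cos_le_exp_norm (z : ℂ) : ‖Complex.cos z‖ ≤ Real.exp ‖z‖ := by
  have h1 : ‖Complex.exp (z * Complex.I)‖ ≤ Real.exp ‖z‖ := by
    simpa using Complex.norm_exp_le_exp_norm (z * Complex.I)
  have h2 : ‖Complex.exp (-z * Complex.I)‖ ≤ Real.exp ‖z‖ := by
    simpa using Complex.norm_exp_le_exp_norm (-z * Complex.I)
  rw [Complex.cos, norm_div, Complex.norm_two, div_le_iff₀ two_pos]
  linarith [norm_add_le (Complex.exp (z * Complex.I)) (Complex.exp (-z * Complex.I))]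

open Metric in
theorem DifferentiableOn.exists_cos_eq_on_ball {f : ℂ → ℂ} {c : ℂ} {R M : ℝ}
    (hf : DifferentiableOn ℂ f (ball c R)) (h1 : ∀ z ∈ ball c R, f z ≠ 1)
    (h2 : ∀ z ∈ ball c R, f z ≠ -1) (hR : 0 < R) (hM : ‖f c‖ ≤ M) :
    ∃ g : ℂ → ℂ, DifferentiableOn ℂ g (ball c R) ∧
      (∀ z ∈ ball c R, Complex.cos (Real.pi * g z) = f z) ∧ ‖g c‖ ≤ 1 + M := by
  have hpi : (Real.pi : ℂ) ≠ 0 := by exact_mod_cast Real.pi_ne_zero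
  obtain ⟨s, hs, hse⟩ := (((differentiableOn_const (1 : ℂ)).sub (hf.pow 2))).exists_exp_eq_on_ball
    (f := fun z => 1 - f z ^ 2) (fun z hz h => by
      rcases mul_self_eq_one_iff.1 (by linear_combination -h : f z * f z = 1) with h | h
      exacts [h1 z hz h, h2 z hz h])
  have hroot : ∀ z ∈ ball c R, Complex.exp (s z / 2) ^ 2 = 1 - f z ^ 2 := by
    intro z hz
    rw [← hse z hz, ← Complex.exp_nat_mul]
    congr 1
    push_cast; ring
  -- With `r = exp (s / 2)` a square root of `1 - f ^ 2`, the product `(f + I r)(f - I r)` is 1, so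
  -- `f + I r` has a logarithm, which yields an inverse cosine of `f`.
  obtain ⟨l, hl, hle⟩ := (hf.add (((hs.div_const 2).cexp).const_mul Complex.I)).exists_exp_eq_on_ball
    (f := fun z => f z + Complex.I * Complex.exp (s z / 2)) (fun z hz h => by
      have := hroot z hz
      have h3 : f z = -(Complex.I * Complex.exp (s z / 2)) := eq_neg_of_add_eq_zero_left h
      rw [h3] at this
      have h4 : Complex.I ^ 2 = -1 := Complex.I_sq
      rw [neg_sq, mul_pow, h4] at this
      norm_num at this)
  have hcos : ∀ z ∈ ball c R, Complex.cos (l z / Complex.I) = f z := by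
    intro z hz
    have h3 : Complex.exp (l z / Complex.I * Complex.I) = f z + Complex.I * Complex.exp (s z / 2) := by
      rw [div_mul_cancel₀ _ Complex.I_ne_zero, hle z hz]
    have h4 : Complex.exp (-(l z / Complex.I) * Complex.I) =
        f z - Complex.I * Complex.exp (s z / 2) := by
      rw [neg_mul, div_mul_cancel₀ _ Complex.I_ne_zero, Complex.exp_neg, hle z hz]
      refine inv_eq_of_mul_eq_one_right ?_
      linear_combination hroot z hz - Complex.exp (s z / 2) ^ 2 * Complex.I_sq
    rw [Complex.cos, h3, h4]
    ring
  obtain ⟨w, hw⟩ : ∃ w, w = l c / Complex.I / Real.pi := ⟨_, rfl⟩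
  have hwc : Complex.cos (Real.pi * w) = f c := by
    rw [hw, mul_div_cancel₀ _ hpi, hcos c (mem_ball_self hR)]
  have him : |w.im| ≤ M := by
    have h3 := abs_im_le_norm_cos (Real.pi * w)
    rw [hwc, Complex.im_ofReal_mul, abs_mul, abs_of_pos Real.pi_pos] at h3
    nlinarith [Real.pi_gt_three, abs_nonneg w.im]
  -- Subtracting an even integer leaves the cosine unchanged and brings the real part at `c` into
  -- `[-1, 1]`.
  refine ⟨fun z => l z / Complex.I / Real.pi - 2 * (round (w.re / 2) : ℤ), ?_, fun z hz => ?_, ?_⟩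
  · exact ((hl.div_const _).div_const _).sub_const _
  · rw [← hcos z hz, mul_sub, mul_div_cancel₀ _ hpi]
    rw [show (Real.pi : ℂ) * (2 * (round (w.re / 2) : ℤ)) = (round (w.re / 2) : ℤ) * (2 * Real.pi) by
      ring, Complex.cos_sub_int_mul_two_pi]
  · simp only [← hw]
    refine (Complex.norm_le_abs_re_add_abs_im _).trans ?_
    have h3 := abs_sub_round (w.re / 2)
    simp only [Complex.sub_re, Complex.sub_im, Complex.mul_re, Complex.mul_im, Complex.re_ofNat,
      Complex.im_ofNat, Complex.intCast_re, Complex.intCast_im, mul_zero, zero_mul, sub_zero,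
      add_zero]
    have h4 : |w.re - 2 * (round (w.re / 2) : ℤ)| ≤ 1 := by
      rw [abs_le] at h3 ⊢
      constructor <;> linarith
    linarith

/-! ### Schottky's theorem and convergence to zero -/

/-- On the vertical lines `Re = k`, `k` an integer, the cosine is `± cosh (π y)`, which grows by at
least 1 over `[|Im w|, |Im w| + 1]` and so meets an integer there. -/
theorem exists_cos_pi_mul_eq_intCast (w : ℂ) :
    ∃ p ∈ Metric.ball w 2, ∃ n : ℤ, Complex.cos (Real.pi * p) = n := by
  obtain ⟨k, hk⟩ : ∃ k, k = round w.re := ⟨_, rfl⟩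
  obtain ⟨m, hm⟩ : ∃ m, m = ⌈Real.cosh (Real.pi * |w.im|)⌉ := ⟨_, rfl⟩
  have hpi := Real.pi_gt_three
  have hv := abs_nonneg w.im
  have h1 : Real.cosh (Real.pi * |w.im|) + 1 ≤ Real.cosh (Real.pi * (|w.im| + 1)) := by
    have h2 : Real.pi + 1 ≤ Real.exp Real.pi := Real.add_one_le_exp _
    have h3 := Real.one_le_cosh (Real.pi * |w.im|)
    have h4 := Real.sinh_nonneg_iff.2 (by positivity : 0 ≤ Real.pi * |w.im|)
    have h5 := Real.sinh_nonneg_iff.2 Real.pi_pos.le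
    have h6 : 2 ≤ Real.cosh Real.pi := by
      rw [Real.cosh_eq]
      linarith [Real.exp_pos (-Real.pi)]
    rw [mul_add, mul_one, Real.cosh_add]
    nlinarith [mul_nonneg h4 h5]
  obtain ⟨q, hq, hqm⟩ := intermediate_value_Icc (by linarith : |w.im| ≤ |w.im| + 1)
    (f := fun y => Real.cosh (Real.pi * y)) (by fun_prop)
    (show (m : ℝ) ∈ Icc _ _ from ⟨hm ▸ Int.le_ceil _,
      (hm ▸ (Int.ceil_lt_add_one _).le).trans h1⟩)
  have h7 : ∀ e : ℝ, Real.cosh (Real.pi * e) = m →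
      ∃ n : ℤ, Complex.cos (Real.pi * ((k : ℂ) + e * Complex.I)) = n := by
    intro e he
    refine ⟨if Even k then m else -m, ?_⟩
    rw [mul_add, ← mul_assoc, ← Complex.ofReal_mul, Complex.cos_add_mul_I, ← Complex.ofReal_cosh, he,
      mul_comm (Real.pi : ℂ), Complex.cos_intCast_mul_pi, Complex.sin_int_mul_pi]
    split_ifs with hk'
    · simp [hk'.neg_one_zpow]
    · simp [(Int.not_even_iff_odd.1 hk').neg_one_zpow]
  have hre : |w.re - k| ≤ 1 / 2 := hk ▸ abs_sub_round _
  have h8 : ∀ e : ℝ, |w.im - e| ≤ 1 → (k : ℂ) + e * Complex.I ∈ Metric.ball w 2 := by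
    intro e he
    rw [Metric.mem_ball, dist_comm, dist_eq_norm]
    refine (Complex.norm_le_abs_re_add_abs_im _).trans_lt ?_
    simp
    linarith
  simp only at hqm
  rcases le_total 0 w.im with h | h
  · rw [abs_of_nonneg h] at hq
    exact ⟨_, h8 q (by rw [abs_le]; constructor <;> linarith [hq.1, hq.2]), h7 q hqm⟩
  · rw [abs_of_nonpos h] at hq
    exact ⟨_, h8 (-q) (by rw [abs_le]; constructor <;> linarith [hq.1, hq.2]),
      h7 (-q) (by rw [mul_neg, Real.cosh_neg, hqm])⟩

open Metric in
/-- **Schottky's theorem**. -/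
theorem exists_norm_le_of_omits_zero_one (M : ℝ) :
    ∃ C : ℝ, ∀ (f : ℂ → ℂ) (c : ℂ) (R : ℝ), DifferentiableOn ℂ f (ball c R) →
      (∀ z ∈ ball c R, f z ≠ 0) → (∀ z ∈ ball c R, f z ≠ 1) → ‖f c‖ ≤ M →
      ∀ z ∈ ball c (R / 2), ‖f z‖ ≤ C := by
  -- Here `2 f - 1 = cos (π F)` and `F = cos (π G)`, with `‖G c‖ ≤ 2M + 3`; Bloch adds `96 * 2`,
  -- since `G` omits every point whose cosine `cos (π p)` is an integer.
  refine ⟨(1 + Real.exp (Real.pi * Real.exp (Real.pi * (2 * M + 195)))) / 2, ?_⟩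
  intro f c R hf h0 h1 hM z hz
  have hR : 0 < R := by linarith [pos_of_mem_ball hz]
  have hsub : ball c (R / 2) ⊆ ball c R := ball_subset_ball (by linarith)
  obtain ⟨F, hF, hFe, hFc⟩ := ((hf.const_mul 2).sub_const 1).exists_cos_eq_on_ball
    (f := fun z => 2 * f z - 1) (M := 2 * M + 1)
    (fun z hz h => h1 z hz (by linear_combination h / 2))
    (fun z hz h => h0 z hz (by linear_combination h / 2)) hR
    ((norm_sub_le _ _).trans (by simp; linarith))
  have hFn : ∀ z ∈ ball c R, ∀ n : ℤ, F z ≠ n := by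
    intro z hz n hn
    have h2 := hFe z hz
    rw [hn, mul_comm, Complex.cos_intCast_mul_pi] at h2
    rcases Int.even_or_odd n with h | h
    · rw [h.neg_one_zpow] at h2
      exact h1 z hz (by linear_combination -h2 / 2)
    · rw [h.neg_one_zpow] at h2
      exact h0 z hz (by linear_combination -h2 / 2)
  obtain ⟨G, hG, hGe, hGc⟩ := hF.exists_cos_eq_on_ball
    (fun z hz h => hFn z hz 1 (by simpa using h))
    (fun z hz h => hFn z hz (-1) (by simpa using h)) hR hFc
  have h3 : ‖G z - G c‖ ≤ 96 * 2 := by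
    refine norm_sub_le_of_forall_exists_notMem_image hG (fun w => ?_) hz
    obtain ⟨p, hp, n, hn⟩ := exists_cos_pi_mul_eq_intCast w
    refine ⟨p, hp, ?_⟩
    rintro ⟨y, hy, rfl⟩
    exact hFn y hy n (by rw [← hGe y hy, hn])
  have h4 : ‖G z‖ ≤ 2 * M + 195 := by
    linarith [norm_le_norm_add_norm_sub (G c) (G z), norm_sub_rev (G c) (G z)]
  have h5 : ‖F z‖ ≤ Real.exp (Real.pi * (2 * M + 195)) := by
    rw [← hGe z (hsub hz)]
    refine (norm_cos_le_exp_norm _).trans (Real.exp_le_exp.2 ?_)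
    rw [norm_mul, Complex.norm_real, Real.norm_of_nonneg Real.pi_pos.le]
    gcongr
  have h6 : ‖2 * f z - 1‖ ≤ Real.exp (Real.pi * Real.exp (Real.pi * (2 * M + 195))) := by
    rw [← hFe z (hsub hz)]
    refine (norm_cos_le_exp_norm _).trans (Real.exp_le_exp.2 ?_)
    rw [norm_mul, Complex.norm_real, Real.norm_of_nonneg Real.pi_pos.le]
    gcongr
  have h7 : ‖2 * f z‖ ≤ ‖2 * f z - 1‖ + 1 := by
    simpa using norm_add_le (2 * f z - 1) 1
  rw [norm_mul, Complex.norm_two] at h7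
  linarith

open Metric in
/-- A Harnack-type inequality. -/
theorem norm_pow_three_le_of_forall_ne_zero {f : ℂ → ℂ} {c z : ℂ} {R C : ℝ}
    (hf : DifferentiableOn ℂ f (ball c R)) (h0 : ∀ z ∈ ball c R, f z ≠ 0)
    (hC : ∀ z ∈ ball c R, ‖f z‖ ≤ C) (hz : z ∈ ball c (R / 4)) :
    ‖f z‖ ^ 3 ≤ C ^ 2 * ‖f c‖ := by
  have hR : 0 < R := by linarith [pos_of_mem_ball hz]
  have hc : c ∈ ball c R := mem_ball_self hR
  have hzR : z ∈ ball c R := ball_subset_ball (by linarith) hz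
  obtain ⟨g, hg, hge⟩ := hf.exists_exp_eq_on_ball h0
  have hre : ∀ w ∈ ball c R, Real.exp (g w).re = ‖f w‖ := fun w hw => by
    rw [← hge w hw, Complex.norm_exp]
  have hC0 : 0 < C := (norm_pos_iff.2 (h0 c hc)).trans_le (hC c hc)
  have hle : ∀ w ∈ ball c R, (g w).re ≤ Real.log C := fun w hw => by
    rw [Real.le_log_iff_exp_le hC0, hre w hw]
    exact hC w hw
  -- Borel–Carathéodory for `g - g c`: the factor `2ρ / (R - ρ)` is at most `2 / 3` for `ρ < R / 4`.
  -- It needs a strictly positive bound, so the equality case is separate.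
  have key : (g z).re ≤ Real.log C - (Real.log C - (g c).re) / 3 := by
    rcases (hle c hc).eq_or_lt with h | h
    · linarith [hle z hzR]
    · have hmem : z - c ∈ ball (0 : ℂ) R := by
        rw [mem_ball_zero_iff]; simpa [dist_eq_norm] using hzR
      have hmaps : MapsTo (fun w => c + w) (ball (0 : ℂ) R) (ball c R) := fun w hw => by
        simpa [dist_eq_norm] using hw
      have h1 := Complex.borelCaratheodory_zero (f := fun w => g (c + w) - g c)
        (M := Real.log C - (g c).re) (sub_pos.2 h)
        ((hg.comp (by fun_prop) hmaps).sub_const _)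
        (fun w hw => by
          have := hle _ (hmaps hw)
          simpa using this) hR hmem (by simp)
      simp only [add_sub_cancel] at h1
      have h2 : ‖z - c‖ < R / 4 := by simpa [dist_eq_norm] using hz
      have h3 : 2 * (Real.log C - (g c).re) * ‖z - c‖ / (R - ‖z - c‖) ≤
          2 * (Real.log C - (g c).re) / 3 := by
        rw [div_le_iff₀ (by linarith)]
        nlinarith [norm_nonneg (z - c)]
      have h4 := Complex.re_le_norm (g z - g c)
      rw [Complex.sub_re] at h4
      linarith
  calc ‖f z‖ ^ 3 = Real.exp (3 * (g z).re) := by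
        rw [← hre z hzR, ← Real.exp_nat_mul]; norm_num
    _ ≤ Real.exp (2 * Real.log C + (g c).re) := Real.exp_le_exp.2 (by linarith)
    _ = C ^ 2 * ‖f c‖ := by
        rw [Real.exp_add, hre c hc, mul_comm 2, Real.exp_mul, Real.exp_log hC0]
        norm_num

open Metric in
-- Schottky bounds the family uniformly on the half disc; the Harnack inequality on a quarter of
-- that then transfers smallness from the centre.
theorem eventually_forall_norm_lt_of_tendsto_zero_of_omits {ι : Type*} {l : Filter ι}
    {g : ι → ℂ → ℂ} {c : ℂ} {R ε : ℝ} (hR : 0 < R) (hε : 0 < ε)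
    (hd : ∀ᶠ i in l, DifferentiableOn ℂ (g i) (ball c R))
    (h0 : ∀ᶠ i in l, ∀ z ∈ ball c R, g i z ≠ 0) (h1 : ∀ᶠ i in l, ∀ z ∈ ball c R, g i z ≠ 1)
    (hc : Tendsto (fun i => g i c) l (𝓝 0)) :
    ∀ᶠ i in l, ∀ z ∈ ball c (R / 8), ‖g i z‖ < ε := by
  obtain ⟨C, hC⟩ := exists_norm_le_of_omits_zero_one 1
  have h2 : Tendsto (fun i => C ^ 2 * ‖g i c‖) l (𝓝 0) := by
    simpa using hc.norm.const_mul (C ^ 2)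
  have h3 : ∀ᶠ i in l, ‖g i c‖ < 1 := hc.norm.eventually_lt_const (by simp)
  filter_upwards [hd, h0, h1, h2.eventually_lt_const (by positivity : 0 < ε ^ 3), h3]
    with i hd h0 h1 h2 h3 z hz
  have hsub : ball c (R / 2) ⊆ ball c R := ball_subset_ball (by linarith)
  have h4 := norm_pow_three_le_of_forall_ne_zero (hd.mono hsub) (fun w hw => h0 w (hsub hw))
    (hC _ c R hd h0 h1 h3.le) (ball_subset_ball (by linarith) hz)
  exact lt_of_pow_lt_pow_left₀ 3 hε.le (h4.trans_lt h2)

open Metric in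
-- The points of `U` at which the family tends to 0 form a relatively clopen subset.
theorem tendstoLocallyUniformlyOn_zero_of_omits {ι : Type*} {l : Filter ι} {U : Set ℂ}
    {g : ι → ℂ → ℂ} {p : ℂ} (hU : IsOpen U) (hU' : IsPreconnected U) (hp : p ∈ U)
    (hd : ∀ᶠ i in l, DifferentiableOn ℂ (g i) U)
    (h0 : ∀ᶠ i in l, ∀ z ∈ U, g i z ≠ 0) (h1 : ∀ᶠ i in l, ∀ z ∈ U, g i z ≠ 1)
    (hg : Tendsto (fun i => g i p) l (𝓝 0)) :
    TendstoLocallyUniformlyOn g 0 l U := by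
  have loc : ∀ c R, 0 < R → ball c R ⊆ U → Tendsto (fun i => g i c) l (𝓝 0) → ∀ ε > 0,
      ∀ᶠ i in l, ∀ z ∈ ball c (R / 8), ‖g i z‖ < ε := fun c R hR hs hc ε hε =>
    eventually_forall_norm_lt_of_tendsto_zero_of_omits hR hε
      (hd.mono fun i h => h.mono hs) (h0.mono fun i h z hz => h z (hs hz))
      (h1.mono fun i h z hz => h z (hs hz)) hc
  have loc' : ∀ c R, 0 < R → ball c R ⊆ U → Tendsto (fun i => g i c) l (𝓝 0) →
      ∀ z ∈ ball c (R / 8), Tendsto (fun i => g i z) l (𝓝 0) := by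
    intro c R hR hs hc z hz
    rw [tendsto_zero_iff_norm_tendsto_zero, Metric.tendsto_nhds]
    intro ε hε
    filter_upwards [loc c R hR hs hc ε hε] with i hi
    simpa using hi z hz
  have hsub : U ⊆ {c | c ∈ U ∧ Tendsto (fun i => g i c) l (𝓝 0)} := by
    refine hU'.subset_of_closure_inter_subset ?_ ⟨p, hp, hp, hg⟩ ?_
    · rw [Metric.isOpen_iff]
      rintro c ⟨hc, hc'⟩
      obtain ⟨R, hR, hs⟩ := Metric.isOpen_iff.1 hU c hc
      exact ⟨R / 8, by positivity, fun z hz => ⟨hs (ball_subset_ball (by linarith) hz),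
        loc' c R hR hs hc' z hz⟩⟩
    · rintro c ⟨hc, hcU⟩
      obtain ⟨R, hR, hs⟩ := Metric.isOpen_iff.1 hU c hcU
      -- `R / 32` is below `(R / 2) / 8`, so `c` lies in the disc controlled from `d`.
      obtain ⟨d, ⟨-, hd'⟩, hcd⟩ := Metric.mem_closure_iff.1 hc (R / 32) (by positivity)
      refine ⟨hcU, loc' d (R / 2) (by positivity) ?_ hd' c ?_⟩
      · exact (ball_subset_ball' (by rw [dist_comm]; linarith)).trans hs
      · rw [mem_ball]; linarith
  rw [Metric.tendstoLocallyUniformlyOn_iff]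
  intro ε hε c hc
  obtain ⟨R, hR, hs⟩ := Metric.isOpen_iff.1 hU c hc
  refine ⟨ball c (R / 8), mem_nhdsWithin_of_mem_nhds (ball_mem_nhds _ (by positivity)), ?_⟩
  filter_upwards [loc c R hR hs (hsub hc).2 ε hε] with i hi z hz
  simpa using hi z hz

/-! ### The great Picard theorem -/

theorem meromorphicAt_of_tendsto_nhdsNE {h : ℂ → ℂ} {q c : ℂ}
    (hd : ∀ᶠ z in 𝓝[≠] q, DifferentiableAt ℂ h z) (hc : Tendsto h (𝓝[≠] q) (𝓝 c)) :
    MeromorphicAt h q := by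
  have heq : ∀ᶠ z in 𝓝[≠] q, Function.update h q c z = h z :=
    eventually_mem_nhdsWithin.mono fun z hz => Function.update_of_ne hz _ _
  have han : AnalyticAt ℂ (Function.update h q c) q := by
    refine Complex.analyticAt_of_differentiable_on_punctured_nhds_of_continuousAt ?_
      (continuousAt_update_same.2 hc)
    filter_upwards [hd, eventually_eventually_nhdsWithin.2 heq, self_mem_nhdsWithin] with z h1 h2 h3
    rw [isOpen_compl_singleton.nhdsWithin_eq h3] at h2
    exact h1.congr_of_eventuallyEq h2
  exact han.meromorphicAt.congr heq

open Metric in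
-- Schottky is applied to the pullback by `u ↦ q + (w - q) exp u` on the disc of radius 8: its half
-- disc contains the segment `|Im u| ≤ π`, `Re u = 0`, which covers the circle, and the factor `exp
-- 8` keeps the image inside the punctured disc.
theorem exists_norm_le_on_circle_of_omits_zero_one (M : ℝ) :
    ∃ C : ℝ, ∀ (h : ℂ → ℂ) (q : ℂ) (R : ℝ), DifferentiableOn ℂ h (ball q R \ {q}) →
      (∀ z ∈ ball q R \ {q}, h z ≠ 0) → (∀ z ∈ ball q R \ {q}, h z ≠ 1) →
      ∀ w ≠ q, dist w q * Real.exp 8 < R → ‖h w‖ ≤ M →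
      ∀ z ∈ sphere q (dist w q), ‖h z‖ ≤ C := by
  obtain ⟨C, hC⟩ := exists_norm_le_of_omits_zero_one M
  refine ⟨C, fun h q R hd h0 h1 w hw hwR hM z hz => ?_⟩
  have hw0 : w - q ≠ 0 := sub_ne_zero.2 hw
  rw [mem_sphere, dist_eq_norm, dist_eq_norm] at hz
  have hz0 : z - q ≠ 0 := by rw [← norm_ne_zero_iff, hz, norm_ne_zero_iff]; exact hw0
  have hmaps : MapsTo (fun u => q + (w - q) * Complex.exp u) (ball 0 8) (ball q R \ {q}) := by
    intro u hu
    refine ⟨?_, by simp [hw0, Complex.exp_ne_zero]⟩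
    rw [mem_ball, dist_eq_norm, add_sub_cancel_left, norm_mul, ← dist_eq_norm]
    refine lt_of_le_of_lt ?_ hwR
    gcongr
    refine (Complex.norm_exp_le_exp_norm u).trans (Real.exp_le_exp.2 ?_)
    exact (mem_ball_zero_iff.1 hu).le
  have hu : Complex.log ((z - q) / (w - q)) ∈ ball (0 : ℂ) (8 / 2) := by
    rw [mem_ball_zero_iff]
    refine (Complex.norm_le_abs_re_add_abs_im _).trans_lt ?_
    rw [Complex.log_re, Complex.log_im, norm_div, hz, div_self (norm_ne_zero_iff.2 hw0)]
    have := Complex.abs_arg_le_pi ((z - q) / (w - q))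
    simp only [Real.log_one, abs_zero]
    linarith [Real.pi_lt_four]
  have := hC (fun u => h (q + (w - q) * Complex.exp u)) 0 8 (hd.comp (by fun_prop) hmaps)
    (fun u hu => h0 _ (hmaps hu)) (fun u hu => h1 _ (hmaps hu)) (by simpa using hM) _ hu
  rwa [Complex.exp_log (div_ne_zero hz0 hw0), mul_div_cancel₀ _ hw0, add_sub_cancel] at this

open Metric in
theorem norm_le_of_forall_sphere_norm_le {h : ℂ → ℂ} {q z : ℂ} {r₁ r₂ C : ℝ} (hr₁ : 0 < r₁)
    (hd : DifferentiableOn ℂ h (closedBall q r₂ \ {q})) (h₁ : ∀ w ∈ sphere q r₁, ‖h w‖ ≤ C)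
    (h₂ : ∀ w ∈ sphere q r₂, ‖h w‖ ≤ C) (hz₁ : r₁ < dist z q) (hz₂ : dist z q < r₂) :
    ‖h z‖ ≤ C := by
  have hcl : closure (ball q r₂ \ closedBall q r₁) ⊆ closedBall q r₂ \ ball q r₁ :=
    closure_minimal (fun w hw => ⟨ball_subset_closedBall hw.1, fun h => hw.2
      (ball_subset_closedBall h)⟩) (isClosed_closedBall.sdiff isOpen_ball)
  refine Complex.norm_le_of_forall_mem_frontier_norm_le (U := ball q r₂ \ closedBall q r₁)
    (isBounded_ball.subset sdiff_subset) ?_ (fun w hw => ?_)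
    (subset_closure ⟨hz₂, fun h => absurd (mem_closedBall.1 h) (not_le.2 hz₁)⟩)
  · refine (hd.mono (hcl.trans ?_)).diffContOnCl
    exact fun w hw => ⟨hw.1, fun h => hw.2 (by rw [h]; exact mem_ball_self hr₁)⟩
  · have ho : IsOpen (ball q r₂ \ closedBall q r₁) := isOpen_ball.sdiff isClosed_closedBall
    rw [ho.frontier_eq] at hw
    obtain ⟨hw1, hw2⟩ := hcl hw.1
    rw [mem_closedBall] at hw1
    rw [mem_ball, not_lt] at hw2
    rcases hw1.eq_or_lt with h | h
    · exact h₂ w h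
    · rcases hw2.eq_or_lt with h' | h'
      · exact h₁ w h'.symm
      · exact absurd ⟨h, fun h'' => absurd (mem_closedBall.1 h'') (not_le.2 h')⟩ hw.2

open Metric in
/-- The **great Picard theorem**: a holomorphic function omitting two values on a punctured disc
has no essential singularity at the centre. -/
theorem meromorphicAt_of_omits_zero_one {h : ℂ → ℂ} {q : ℂ} {R : ℝ} (hR : 0 < R)
    (hd : DifferentiableOn ℂ h (ball q R \ {q})) (h0 : ∀ z ∈ ball q R \ {q}, h z ≠ 0)
    (h1 : ∀ z ∈ ball q R \ {q}, h z ≠ 1) : MeromorphicAt h q := by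
  have hmem : ball q R \ {q} ∈ 𝓝[≠] q := sdiff_mem_nhdsWithin_compl (ball_mem_nhds q hR) _
  have hopen : IsOpen (ball q R \ {q}) := isOpen_ball.sdiff isClosed_singleton
  have hda : ∀ᶠ z in 𝓝[≠] q, DifferentiableAt ℂ h z :=
    mem_of_superset hmem fun z hz => hd.differentiableAt (hopen.mem_nhds hz)
  by_cases ht : Tendsto (fun z => ‖h z‖) (𝓝[≠] q) atTop
  · have hi : Tendsto h⁻¹ (𝓝[≠] q) (𝓝 0) :=
      tendsto_inv₀_cobounded.comp (tendsto_norm_atTop_iff_cobounded.1 ht)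
    have hm : MeromorphicAt h⁻¹ q := by
      refine meromorphicAt_of_tendsto_nhdsNE ?_ hi
      filter_upwards [hda, hmem] with z h2 h3 using h2.inv (h0 z h3)
    simpa using hm.inv
  · obtain ⟨M, hM⟩ : ∃ M : ℝ, ∃ᶠ z in 𝓝[≠] q, ‖h z‖ ≤ M := by
      by_contra! hcon
      refine ht (tendsto_atTop.2 fun M => ?_)
      exact (hcon M).mono fun z hz => hz.le
    obtain ⟨C, hC⟩ := exists_norm_le_on_circle_of_omits_zero_one M
    have hexists : ∀ r > 0, ∃ w ≠ q, dist w q < r ∧ ‖h w‖ ≤ M := by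
      intro r hr
      obtain ⟨w, hw, hw'⟩ := (hM.and_eventually
        (sdiff_mem_nhdsWithin_compl (ball_mem_nhds q hr) {q})).exists
      exact ⟨w, hw'.2, hw'.1, hw⟩
    have he : (0 : ℝ) < Real.exp 8 := Real.exp_pos 8
    obtain ⟨w, hwq, hwR, hwM⟩ := hexists (R / Real.exp 8) (by positivity)
    have hwR' : dist w q < R := hwR.trans_le (div_le_self hR.le (Real.one_le_exp (by norm_num)))
    -- Points where `‖h‖ ≤ M` accumulate at `q`, so `z` lies in an annulus whose two boundary
    -- circles pass through such points; the maximum principle gives the bound.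
    have hbd : ∀ z ∈ ball q (dist w q) \ {q}, ‖h z‖ ≤ C := by
      rintro z ⟨hz, hzq⟩
      obtain ⟨v, hvq, hvz, hvM⟩ := hexists (dist z q) (dist_pos.2 hzq)
      refine norm_le_of_forall_sphere_norm_le (dist_pos.2 hvq)
        (hd.mono (sdiff_subset_sdiff_left (closedBall_subset_ball hwR')))
        (hC h q R hd h0 h1 v hvq ?_ hvM)
        (hC h q R hd h0 h1 w hwq ((lt_div_iff₀ he).1 hwR) hwM) hvz hz
      exact (lt_div_iff₀ he).1 ((hvz.trans hz).trans hwR)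
    refine meromorphicAt_of_tendsto_nhdsNE hda
      (Complex.tendsto_limUnder_of_differentiable_on_punctured_nhds_of_bounded_under hda
        ⟨C + ‖h q‖, eventually_map.2 ?_⟩)
    filter_upwards [sdiff_mem_nhdsWithin_compl (ball_mem_nhds q (dist_pos.2 hwq)) {q}] with z hz
    exact (norm_sub_le _ _).trans (by linarith [hbd z hz])

/-! ### Order zero from closeness to 1 on a circle -/

open Metric in
-- Without a pole `Q` extends over `q`, and the maximum principle for `Q - 1` keeps its value there
-- away from 0.
theorem meromorphicOrderAt_eq_zero_of_nonneg {Q : ℂ → ℂ} {q : ℂ} {r R δ : ℝ} (hr : 0 < r)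
    (hrR : r < R) (hδ : δ < 1) (hm : MeromorphicAt Q q) (ho : 0 ≤ meromorphicOrderAt Q q)
    (hd : DifferentiableOn ℂ Q (ball q R \ {q})) (hQ : ∀ z ∈ sphere q r, ‖Q z - 1‖ ≤ δ) :
    meromorphicOrderAt Q q = 0 := by
  obtain ⟨c, hc⟩ := tendsto_nhds_of_meromorphicOrderAt_nonneg hm ho
  have hu : DifferentiableOn ℂ (Function.update Q q c) (ball q R) := by
    rw [← Complex.differentiableOn_compl_singleton_and_continuousAt_iff
      (ball_mem_nhds q (hr.trans hrR))]
    exact ⟨hd.congr fun z hz => Function.update_of_ne hz.2 _ _, continuousAt_update_same.2 hc⟩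
  have h1 : ‖Function.update Q q c q - 1‖ ≤ δ := by
    refine Complex.norm_le_of_forall_mem_frontier_norm_le (isBounded_ball (x := q) (r := r))
      (((hu.mono (closedBall_subset_ball hrR)).diffContOnCl_ball subset_rfl).sub_const 1)
      (fun z hz => ?_) (subset_closure (mem_ball_self hr))
    rw [frontier_ball q hr.ne'] at hz
    have : z ≠ q := ne_of_mem_sphere hz hr.ne'
    rw [Function.update_of_ne this]
    exact hQ z hz
  rw [Function.update_self] at h1
  refine (tendsto_ne_zero_iff_meromorphicOrderAt_eq_zero hm).1 ⟨c, ?_, hc⟩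
  rintro rfl
  norm_num at h1
  linarith

open Metric in
-- A pole of `Q` would be a zero of `Q⁻¹`, which is within `(1/3) / (2/3) = 1/2` of 1 on the circle.
theorem meromorphicOrderAt_eq_zero_of_norm_sub_one_le {Q : ℂ → ℂ} {q : ℂ} {r R : ℝ} (hr : 0 < r)
    (hrR : r < R) (hm : MeromorphicAt Q q) (hd : DifferentiableOn ℂ Q (ball q R \ {q}))
    (h0 : ∀ z ∈ ball q R \ {q}, Q z ≠ 0) (hQ : ∀ z ∈ sphere q r, ‖Q z - 1‖ ≤ 1 / 3) :
    meromorphicOrderAt Q q = 0 := by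
  rcases le_or_gt 0 (meromorphicOrderAt Q q) with h | h
  · exact meromorphicOrderAt_eq_zero_of_nonneg hr hrR (by norm_num) hm h hd hQ
  · have hinv : meromorphicOrderAt Q⁻¹ q = -meromorphicOrderAt Q q := meromorphicOrderAt_inv
    have h1 : meromorphicOrderAt Q⁻¹ q = 0 := by
      refine meromorphicOrderAt_eq_zero_of_nonneg (δ := 1 / 2) hr hrR (by norm_num) hm.inv ?_
        (hd.inv h0) fun z hz => ?_
      · rw [hinv]
        cases hv : meromorphicOrderAt Q q with
        | top => rw [hv] at h; simp at h
        | coe n =>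
          rw [hv] at h
          norm_cast at h ⊢
          omega
      · have hz0 : Q z ≠ 0 := h0 z ⟨sphere_subset_closedBall.trans (closedBall_subset_ball hrR) hz,
          ne_of_mem_sphere hz hr.ne'⟩
        have h2 := hQ z hz
        have h3 : 2 / 3 ≤ ‖Q z‖ := by
          have := norm_sub_norm_le (1 : ℂ) (1 - Q z)
          rw [sub_sub_cancel, norm_one, norm_sub_rev] at this
          linarith
        have h4 : Q⁻¹ z - 1 = -(Q z - 1) / Q z := by
          rw [Pi.inv_apply]; field_simp; ring
        rw [h4, norm_div, norm_neg, div_le_iff₀ (by linarith)]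
        linarith
    rw [meromorphicOrderAt_inv] at h1
    cases hv : meromorphicOrderAt Q q with
    | top => rw [hv] at h; simp at h
    | coe n =>
      rw [hv] at h1
      norm_cast at h1 ⊢
      omega

/-! ### Differences of trajectories near the puncture -/

theorem IsPreconnected.forall_of_eventually_iff {X : Type*} [TopologicalSpace X] {s : Set X}
    (hs : IsPreconnected s) {P : X → Prop} (hP : ∀ a ∈ s, ∀ᶠ z in 𝓝[s] a, (P z ↔ P a)) {x y : X}
    (hx : x ∈ s) (hy : y ∈ s) (h : P x) : P y := by
  classical
  have hc : ContinuousOn (fun z => decide (P z)) s := fun a ha => by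
    have : (fun z => decide (P z)) =ᶠ[𝓝[s] a] fun _ => decide (P a) := by
      filter_upwards [hP a ha] with z hz using by simp [hz]
    exact (continuousWithinAt_const).congr_of_eventuallyEq this rfl
  have := hs.constant hc hx hy
  simpa [h] using this

section

variable {U E : Set ℂ} {p q : ℂ} {K : ℂ → ℂ → ℂ}

theorem IsHolomorphicMotion.sub_ne_zero (hK : IsHolomorphicMotion U E p K) {l z w : ℂ}
    (hl : l ∈ U) (hz : z ∈ E) (hw : w ∈ E) (h : z ≠ w) : K l z - K l w ≠ 0 :=
  _root_.sub_ne_zero.2 fun h' => h (hK.vertically_injective l hl hz hw h')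

open Metric in
theorem IsHolomorphicMotion.eventually_meromorphicOrderAt_sub_eq {R : ℝ}
    (hK : IsHolomorphicMotion U E p K) (hR : 0 < R) (hU : ball q R \ {q} ⊆ U)
    (hm : ∀ z ∈ E, MeromorphicAt (fun l => K l z) q) {a b : ℂ} (ha : a ∈ E) (hb : b ∈ E)
    (hab : a ≠ b) :
    ∀ᶠ z in 𝓝[E] a, meromorphicOrderAt (fun l => K l z - K l b) q =
      meromorphicOrderAt (fun l => K l a - K l b) q := by
  have hnear : ∀ᶠ z in 𝓝[E \ {a}] a, z ∈ E ∧ z ≠ a ∧ z ≠ b := by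
    filter_upwards [self_mem_nhdsWithin, nhdsWithin_le_nhds (isOpen_ne.mem_nhds hab)] with z h1 h2
    exact ⟨h1.1, h1.2, h2⟩
  have hd : ∀ z ∈ E, DifferentiableOn ℂ (fun l => K l z) U := hK.horizontally_holomorphic
  have hunif : TendstoLocallyUniformlyOn (fun z l => (K l z - K l a) / (K l b - K l a)) 0
      (𝓝[E \ {a}] a) U := by
    refine tendstoLocallyUniformlyOn_zero_of_omits hK.isOpen hK.isConnected.isPreconnected
      hK.base_mem ?_ ?_ ?_ ?_
    · filter_upwards [hnear] with z hz
      exact ((hd z hz.1).sub (hd a ha)).div ((hd b hb).sub (hd a ha))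
        fun l hl => hK.sub_ne_zero hl hb ha hab.symm
    · filter_upwards [hnear] with z hz l hl
      exact div_ne_zero (hK.sub_ne_zero hl hz.1 ha hz.2.1) (hK.sub_ne_zero hl hb ha hab.symm)
    · filter_upwards [hnear] with z hz l hl h
      rw [div_eq_one_iff_eq (hK.sub_ne_zero hl hb ha hab.symm)] at h
      exact hK.sub_ne_zero hl hz.1 hb hz.2.2 (by linear_combination h)
    · have h1 : Tendsto (fun z : ℂ => (z - a) / (b - a)) (𝓝[E \ {a}] a) (𝓝 0) := by
        have : ContinuousAt (fun z : ℂ => (z - a) / (b - a)) a := by fun_prop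
        simpa using this.tendsto.mono_left nhdsWithin_le_nhds
      refine h1.congr' ?_
      filter_upwards [hnear] with z hz
      rw [hK.map_base z hz.1, hK.map_base a ha, hK.map_base b hb]
  have hsphere : sphere q (R / 2) ⊆ U := fun z hz => hU
    ⟨sphere_subset_closedBall.trans (closedBall_subset_ball (by linarith)) hz,
      ne_of_mem_sphere hz (by positivity)⟩
  have hsmall := Metric.tendstoUniformlyOn_iff.1
    ((tendstoLocallyUniformlyOn_iff_tendstoUniformlyOn_of_compact
      (isCompact_sphere q (R / 2))).1 (hunif.mono hsphere)) (1 / 3) (by norm_num)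
  have hne : ∀ᶠ z in 𝓝[E \ {a}] a, meromorphicOrderAt (fun l => K l z - K l b) q =
      meromorphicOrderAt (fun l => K l a - K l b) q := by
    filter_upwards [hnear, hsmall] with z hz hs
    have hab' : ∀ l ∈ U, K l a - K l b ≠ 0 := fun l hl => hK.sub_ne_zero hl ha hb hab
    have hQm : MeromorphicAt (fun l => (K l z - K l b) / (K l a - K l b)) q :=
      ((hm z hz.1).sub (hm b hb)).div ((hm a ha).sub (hm b hb))
    have h0 : meromorphicOrderAt (fun l => (K l z - K l b) / (K l a - K l b)) q = 0 := by
      refine meromorphicOrderAt_eq_zero_of_norm_sub_one_le (r := R / 2) (R := R) (by positivity)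
        (by linarith) hQm ?_ ?_ ?_
      · exact (((hd z hz.1).sub (hd b hb)).div ((hd a ha).sub (hd b hb)) hab').mono hU
      · exact fun l hl => div_ne_zero (hK.sub_ne_zero (hU hl) hz.1 hb hz.2.2) (hab' l (hU hl))
      · intro l hl
        have h1 := hab' l (hsphere hl)
        have h1' : K l b - K l a ≠ 0 := hK.sub_ne_zero (hsphere hl) hb ha hab.symm
        have h2 : (K l z - K l b) / (K l a - K l b) - 1 =
            -((K l z - K l a) / (K l b - K l a)) := by
          field_simp
          ring
        rw [h2, norm_neg]
        have h3 := hs l hl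
        rw [Pi.zero_apply, dist_zero_left] at h3
        exact h3.le
    have hmul := meromorphicOrderAt_mul hQm ((hm a ha).sub (hm b hb))
    rw [h0, zero_add] at hmul
    refine (meromorphicOrderAt_congr ?_).trans hmul
    filter_upwards [sdiff_mem_nhdsWithin_compl (ball_mem_nhds q hR) {q}] with l hl
    exact (div_mul_cancel₀ _ (hab' l (hU hl))).symm
  rw [← insert_sdiff_self_of_mem ha]
  exact mem_nhdsWithin_insert.2 ⟨rfl, hne⟩

end

section

variable {U E : Set ℂ} {p q : ℂ} {K : ℂ → ℂ → ℂ}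

theorem meromorphicOrderAt_sub_comm (f g : ℂ → ℂ) (x : ℂ) :
    meromorphicOrderAt (fun l => f l - g l) x = meromorphicOrderAt (fun l => g l - f l) x := by
  rw [meromorphicOrderAt_fun_neg]
  simp

open Metric in
theorem IsHolomorphicMotion.meromorphicOrderAt_sub_le {R : ℝ} (hE : IsPreconnected E)
    (hK : IsHolomorphicMotion U E p K) (hR : 0 < R) (hU : ball q R \ {q} ⊆ U)
    (hm : ∀ z ∈ E, MeromorphicAt (fun l => K l z) q) {a b z : ℂ} (ha : a ∈ E) (hb : b ∈ E)
    (hz : z ∈ E) (hab : a ≠ b) (hza : z ≠ a) :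
    meromorphicOrderAt (fun l => K l a - K l b) q ≤
      meromorphicOrderAt (fun l => K l z - K l a) q := by
  have key := hE.forall_of_eventually_iff (P := fun z => z = a ∨
    meromorphicOrderAt (fun l => K l a - K l b) q ≤ meromorphicOrderAt (fun l => K l z - K l a) q)
    (fun c hc => ?_) ha hz (Or.inl rfl)
  · exact key.resolve_left hza
  -- Near `a` itself, `K w - K a` is a sum of two differences with `K b`, both of the order of `K a
  -- - K b`, so its order is no smaller; elsewhere the order is locally constant.
  rcases eq_or_ne c a with rfl | hca
  · filter_upwards [hK.eventually_meromorphicOrderAt_sub_eq hR hU hm hc hb hab,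
      self_mem_nhdsWithin] with w hw hwE
    refine ⟨fun _ => Or.inl rfl, fun _ => Or.inr ?_⟩
    have h1 := meromorphicOrderAt_add ((hm w hwE).sub (hm b hb)) ((hm b hb).sub (hm c hc))
    have h2 : ((fun l => K l w) - (fun l => K l b)) + ((fun l => K l b) - (fun l => K l c)) =
        fun l => K l w - K l c := by
      ext l
      simp
    rw [h2] at h1
    have h3 := meromorphicOrderAt_sub_comm (fun l => K l b) (fun l => K l c) q
    simp only [Pi.sub_def] at h1
    rw [h3, hw, min_self] at h1
    exact h1
  · filter_upwards [hK.eventually_meromorphicOrderAt_sub_eq hR hU hm hc ha hca,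
      nhdsWithin_le_nhds (isOpen_ne.mem_nhds hca)] with w hw hwa
    have : w ≠ a := hwa
    simp only [this, hca, false_or, hw]

/-- The order at `q` of the difference of two trajectories does not depend on the trajectories. -/
theorem IsHolomorphicMotion.meromorphicOrderAt_sub_eq {R : ℝ} (hE : IsPreconnected E)
    (hK : IsHolomorphicMotion U E p K) (hR : 0 < R) (hU : Metric.ball q R \ {q} ⊆ U)
    (hm : ∀ z ∈ E, MeromorphicAt (fun l => K l z) q) {a b c d : ℂ} (ha : a ∈ E) (hb : b ∈ E)
    (hc : c ∈ E) (hd : d ∈ E) (hab : a ≠ b) (hcd : c ≠ d) :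
    meromorphicOrderAt (fun l => K l a - K l b) q =
      meromorphicOrderAt (fun l => K l c - K l d) q := by
  -- Equality comes from using the inequality twice, with the two other points exchanged.
  have step : ∀ {x y z : ℂ}, x ∈ E → y ∈ E → z ∈ E → x ≠ y → z ≠ x →
      meromorphicOrderAt (fun l => K l x - K l y) q =
        meromorphicOrderAt (fun l => K l x - K l z) q := by
    intro x y z hx hy hz hxy hzx
    refine le_antisymm ?_ ?_
    · rw [meromorphicOrderAt_sub_comm (fun l => K l x) (fun l => K l z)]
      exact hK.meromorphicOrderAt_sub_le hE hR hU hm hx hy hz hxy hzx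
    · rw [meromorphicOrderAt_sub_comm (fun l => K l x) (fun l => K l y)]
      exact hK.meromorphicOrderAt_sub_le hE hR hU hm hx hz hy hzx.symm hxy.symm
  rcases eq_or_ne a c with rfl | hac
  · exact step ha hb hd hab hcd.symm
  · rw [step ha hb hc hab hac.symm,
      meromorphicOrderAt_sub_comm (fun l => K l a) (fun l => K l c)]
    exact step hc ha hd hac.symm hcd.symm

open Metric in
-- All differences share the order 0 of `b - a`: comparison with the constant trajectory of `a`
-- gives finite limits, and nonzero limits of differences give injectivity.
theorem IsHolomorphicMotion.exists_tendsto_of_eq_const {R : ℝ} {a b : ℂ} (hE : IsPreconnected E)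
    (hK : IsHolomorphicMotion U E p K) (hR : 0 < R) (hU : ball q R \ {q} ⊆ U)
    (ha : a ∈ E) (hb : b ∈ E) (hab : a ≠ b) (hKa : ∀ l ∈ U, K l a = a) (hKb : ∀ l ∈ U, K l b = b) :
    ∃ k : ℂ → ℂ, (∀ z ∈ E, Tendsto (fun l => K l z) (𝓝[≠] q) (𝓝 (k z))) ∧ InjOn k E := by
  have hba : b - a ≠ 0 := _root_.sub_ne_zero.2 hab.symm
  have hmem : U ∈ 𝓝[≠] q :=
    mem_of_superset (sdiff_mem_nhdsWithin_compl (ball_mem_nhds q hR) {q}) hU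
  have hconst : ∀ x, (∀ l ∈ U, K l x = x) → (fun _ => x) =ᶠ[𝓝[≠] q] fun l => K l x := fun x hx => by
    filter_upwards [hmem] with l hl using (hx l hl).symm
  have hm : ∀ z ∈ E, MeromorphicAt (fun l => K l z) q := by
    intro z hz
    rcases eq_or_ne z a with rfl | hza
    · exact (MeromorphicAt.const z q).congr (hconst z hKa)
    rcases eq_or_ne z b with rfl | hzb
    · exact (MeromorphicAt.const z q).congr (hconst z hKb)
    have h1 : MeromorphicAt (fun l => (K l z - a) / (b - a)) q := by
      refine meromorphicAt_of_omits_zero_one hR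
        ((((hK.horizontally_holomorphic z hz).mono hU).sub_const a).div_const _) ?_ ?_
      · intro l hl
        have := hK.sub_ne_zero (hU hl) hz ha hza
        rw [hKa l (hU hl)] at this
        exact div_ne_zero this hba
      · intro l hl h
        have := hK.sub_ne_zero (hU hl) hz hb hzb
        rw [hKb l (hU hl)] at this
        rw [div_eq_one_iff_eq hba] at h
        exact this (by linear_combination h)
    have h2 := ((MeromorphicAt.const (b - a) q).mul h1).add (MeromorphicAt.const a q)
    refine h2.congr (Eventually.of_forall fun l => ?_)
    simp only [Pi.add_apply, Pi.mul_apply]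
    field_simp
    ring
  have hord : ∀ z ∈ E, ∀ w ∈ E, z ≠ w → meromorphicOrderAt (fun l => K l z - K l w) q = 0 := by
    intro z hz w hw hzw
    rw [hK.meromorphicOrderAt_sub_eq hE hR hU hm hz hw hb ha hzw hab.symm]
    refine (tendsto_ne_zero_iff_meromorphicOrderAt_eq_zero ((hm b hb).sub (hm a ha))).1
      ⟨b - a, hba, tendsto_const_nhds.congr' ?_⟩
    filter_upwards [hmem] with l hl
    rw [Pi.sub_apply, hKa l hl, hKb l hl]
  have hlim : ∀ z ∈ E, ∃ c, Tendsto (fun l => K l z) (𝓝[≠] q) (𝓝 c) := by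
    intro z hz
    rcases eq_or_ne z a with rfl | hza
    · exact ⟨z, tendsto_const_nhds.congr' (hconst z hKa)⟩
    · obtain ⟨c, -, hc⟩ := tendsto_ne_zero_of_meromorphicOrderAt_eq_zero
        ((hm z hz).sub (hm a ha)) (hord z hz a ha hza)
      refine ⟨c + a, (hc.add_const a).congr' ?_⟩
      filter_upwards [hmem] with l hl
      rw [Pi.sub_apply, hKa l hl, sub_add_cancel]
  choose! k hk using hlim
  refine ⟨k, hk, fun z hz w hw hzw => ?_⟩
  by_contra hne
  obtain ⟨c, hc0, hc⟩ := tendsto_ne_zero_of_meromorphicOrderAt_eq_zero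
    ((hm z hz).sub (hm w hw)) (hord z hz w hw hne)
  have := tendsto_nhds_unique hc ((hk z hz).sub (hk w hw))
  exact hc0 (by rw [this, hzw, sub_self])

end

/-! ### Filling in the isolated boundary point -/

open Metric in
theorem isPreconnected_ball_sdiff_singleton (q : ℂ) (R : ℝ) :
    IsPreconnected (ball q R \ {q}) := by
  rcases le_or_gt R 0 with hR | hR
  · simp [ball_eq_empty.2 hR, isPreconnected_empty]
  have himage : ball q R \ {q} = (fun u => q + Complex.exp u) '' {u | u.re < Real.log R} := by
    ext z
    simp only [Set.mem_sdiff, mem_ball, dist_eq_norm, mem_singleton_iff, mem_image, mem_ofPred_eq]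
    constructor
    · rintro ⟨h1, h2⟩
      have h0 := sub_ne_zero.2 h2
      refine ⟨Complex.log (z - q), ?_, by rw [Complex.exp_log h0]; ring⟩
      rw [Complex.log_re]
      exact Real.log_lt_log (norm_pos_iff.2 h0) h1
    · rintro ⟨u, hu, rfl⟩
      rw [add_sub_cancel_left, Complex.norm_exp]
      exact ⟨(Real.lt_log_iff_exp_lt hR).1 hu, by simp [Complex.exp_ne_zero]⟩
  rw [himage]
  exact (convex_halfSpace_re_lt _).isPreconnected.image _ (by fun_prop)

open Metric in
-- A small punctured disc is connected, meets `D` and misses its frontier.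
theorem IsIsolatedBoundaryPoint.exists_ball_sdiff_subset {D : Set ℂ} {q : ℂ}
    (hq : IsIsolatedBoundaryPoint D q) (hD : IsOpen D) :
    q ∉ D ∧ ∃ R > 0, ball q R \ {q} ⊆ D := by
  obtain ⟨hq1, hq2⟩ := hq
  have hqD : q ∉ D := by
    rw [hD.frontier_eq] at hq1
    exact hq1.2
  refine ⟨hqD, ?_⟩
  obtain ⟨R, hR, hRs⟩ := Metric.mem_nhdsWithin_iff.1 hq2
  refine ⟨R, hR, (isPreconnected_ball_sdiff_singleton q R).subset_of_closure_inter_subset hD ?_ ?_⟩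
  · obtain ⟨w, hwD, hw⟩ := Metric.mem_closure_iff.1 (frontier_subset_closure hq1) R hR
    exact ⟨w, ⟨by rwa [mem_ball, dist_comm], fun h => hqD (h ▸ hwD)⟩, hwD⟩
  · rintro w ⟨hw1, hw2⟩
    by_contra hwD
    exact hRs ⟨hw2.1, hw2.2⟩ (by rw [hD.frontier_eq]; exact ⟨hw1, hwD⟩)

theorem differentiableOn_update_of_tendsto {h : ℂ → ℂ} {D : Set ℂ} {q c : ℂ} (hq : q ∉ D)
    (hD : D ∈ 𝓝[≠] q) (hd : DifferentiableOn ℂ h D) (hc : Tendsto h (𝓝[≠] q) (𝓝 c)) :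
    DifferentiableOn ℂ (Function.update h q c) (D ∪ {q}) := by
  rw [union_singleton, ← Complex.differentiableOn_compl_singleton_and_continuousAt_iff
    (insert_mem_nhds_iff.2 hD), insert_sdiff_self_of_notMem hq]
  exact ⟨hd.congr fun z hz => Function.update_of_ne (ne_of_mem_of_not_mem hz hq) _ _,
    continuousAt_update_same.2 hc⟩

theorem IsHolomorphicMotion.normalizedMotion {D E : Set ℂ} {p z₀ z₁ : ℂ} {H : ℂ → ℂ → ℂ}
    (hH : IsHolomorphicMotion D E p H) (hz₀ : z₀ ∈ E) (hz₁ : z₁ ∈ E) (hne : z₀ ≠ z₁) :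
    IsHolomorphicMotion D E p (normalizedMotion H z₀ z₁) where
  isOpen := hH.isOpen
  isConnected := hH.isConnected
  base_mem := hH.base_mem
  map_base z hz := by
    have : z₁ - z₀ ≠ 0 := _root_.sub_ne_zero.2 hne.symm
    rw [_root_.normalizedMotion, hH.map_base z hz, hH.map_base z₀ hz₀, hH.map_base z₁ hz₁,
      mul_div_cancel₀ _ this, add_sub_cancel]
  vertically_injective l hl z hz w hw h := by
    have h1 : z₁ - z₀ ≠ 0 := _root_.sub_ne_zero.2 hne.symm
    have h2 := hH.sub_ne_zero hl hz₁ hz₀ hne.symm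
    have h3 := mul_left_cancel₀ h1 (add_left_cancel h)
    rw [div_left_inj' h2] at h3
    exact hH.vertically_injective l hl hz hw (sub_left_inj.1 h3)
  horizontally_holomorphic z hz :=
    ((((hH.horizontally_holomorphic z hz).sub (hH.horizontally_holomorphic z₀ hz₀)).div
      ((hH.horizontally_holomorphic z₁ hz₁).sub (hH.horizontally_holomorphic z₀ hz₀))
      fun _ hl => hH.sub_ne_zero hl hz₁ hz₀ hne.symm).const_mul (z₁ - z₀)).const_add z₀

theorem mainTheorem2 (Λstar E : Set ℂ) (lstar l₀ z₀ z₁ : ℂ) (H : ℂ → ℂ → ℂ)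
    (hE : IsConnected E)
    (hstar : IsIsolatedBoundaryPoint Λstar lstar)
    (hH : IsHolomorphicMotion Λstar E l₀ H)
    (hz₀ : z₀ ∈ E) (hz₁ : z₁ ∈ E) (hne : z₀ ≠ z₁)
    (hext₀ : ∃ F, IsHolomorphicExtension Λstar (Λstar ∪ {lstar}) (fun l => H l z₀) F)
    (hext₁ : ∃ F, IsHolomorphicExtension Λstar (Λstar ∪ {lstar}) (fun l => H l z₁) F) :
    ∃ Hext Htilde : ℂ → ℂ → ℂ,
      IsHorizontalExtension Λstar (Λstar ∪ {lstar}) E H Hext ∧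
      IsHorizontalExtension Λstar (Λstar ∪ {lstar}) E (normalizedMotion H z₀ z₁) Htilde ∧
      IsHolomorphicMotion (Λstar ∪ {lstar}) E l₀ Htilde ∧
      (∀ l ∈ Λstar ∪ {lstar}, Htilde l z₀ = z₀ ∧ Htilde l z₁ = z₁) ∧
      ∃ f g : ℂ → ℂ,
        DifferentiableOn ℂ f (Λstar ∪ {lstar}) ∧
        DifferentiableOn ℂ g (Λstar ∪ {lstar}) ∧
        f l₀ = 0 ∧ g l₀ = 1 ∧
        (∀ l ∈ Λstar, g l ≠ 0) ∧
        ∀ l ∈ Λstar ∪ {lstar}, ∀ z ∈ E, Hext l z = f l + g l * Htilde l z := by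
  obtain ⟨hq, R, hR, hU⟩ := hstar.exists_ball_sdiff_subset hH.isOpen
  obtain ⟨F₀, hF₀d, hF₀⟩ := hext₀
  obtain ⟨F₁, hF₁d, hF₁⟩ := hext₁
  have hz : z₁ - z₀ ≠ 0 := sub_ne_zero.2 hne.symm
  have hK := hH.normalizedMotion hz₀ hz₁ hne
  have hK₀ : ∀ l ∈ Λstar, normalizedMotion H z₀ z₁ l z₀ = z₀ := fun l _ => by
    simp [normalizedMotion]
  have hK₁ : ∀ l ∈ Λstar, normalizedMotion H z₀ z₁ l z₁ = z₁ := fun l hl => by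
    rw [normalizedMotion, div_self (hH.sub_ne_zero hl hz₁ hz₀ hne.symm)]
    ring
  obtain ⟨k, hk, hkinj⟩ := hK.exists_tendsto_of_eq_const hE.isPreconnected hR hU hz₀ hz₁ hne
    hK₀ hK₁
  have hmem : Λstar ∈ 𝓝[≠] lstar :=
    mem_of_superset (sdiff_mem_nhdsWithin_compl (Metric.ball_mem_nhds lstar hR) {lstar}) hU
  have hkc : ∀ z ∈ E, (∀ l ∈ Λstar, normalizedMotion H z₀ z₁ l z = z) → k z = z := fun z hzE hc =>
    tendsto_nhds_unique (hk z hzE) (tendsto_const_nhds.congr' (by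
      filter_upwards [hmem] with l hl using (hc l hl).symm))
  obtain ⟨T, hT⟩ : ∃ T : ℂ → ℂ → ℂ,
      T = Function.update (normalizedMotion H z₀ z₁) lstar k := ⟨_, rfl⟩
  have hTs : ∀ l ∈ Λstar, T l = normalizedMotion H z₀ z₁ l := fun l hl => by
    rw [hT, Function.update_of_ne (ne_of_mem_of_not_mem hl hq)]
  have hTl : T lstar = k := by rw [hT, Function.update_self]
  have hTd : ∀ z ∈ E, DifferentiableOn ℂ (fun l => T l z) (Λstar ∪ {lstar}) := fun z hzE => by
    have h1 := differentiableOn_update_of_tendsto hq hmem (hK.horizontally_holomorphic z hzE)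
      (hk z hzE)
    convert! h1 using 1
    ext l
    rcases eq_or_ne l lstar with rfl | hl
    · rw [hTl, Function.update_self]
    · rw [hT, Function.update_of_ne hl, Function.update_of_ne hl]
  have hgd : DifferentiableOn ℂ (fun l => (F₁ l - F₀ l) / (z₁ - z₀)) (Λstar ∪ {lstar}) :=
    (hF₁d.sub hF₀d).div_const _
  have hfd : DifferentiableOn ℂ (fun l => F₀ l - z₀ * ((F₁ l - F₀ l) / (z₁ - z₀)))
      (Λstar ∪ {lstar}) := hF₀d.sub (hgd.const_mul z₀)
  have hl₀ := hH.base_mem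
  -- Solving the definition of the normalized motion for `H` gives `g = (F₁ - F₀) / (z₁ - z₀)` and
  -- `f = F₀ - z₀ g`. Taking `f + g T` as the extension of `H` makes the final identity
  -- definitional; `g` may vanish at `lstar`.
  refine ⟨fun l z => (F₀ l - z₀ * ((F₁ l - F₀ l) / (z₁ - z₀))) +
    (F₁ l - F₀ l) / (z₁ - z₀) * T l z, T, ?_, ?_, ?_, ?_,
    fun l => F₀ l - z₀ * ((F₁ l - F₀ l) / (z₁ - z₀)), fun l => (F₁ l - F₀ l) / (z₁ - z₀),
    hfd, hgd, ?_, ?_, ?_, fun l _ z _ => rfl⟩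
  · refine fun z hzE => ⟨hfd.add (hgd.mul (hTd z hzE)), fun l hl => ?_⟩
    have h1 := hH.sub_ne_zero hl hz₁ hz₀ hne.symm
    simp only [hTs l hl, hF₀ hl, hF₁ hl, normalizedMotion]
    field_simp
    ring
  · exact fun z hzE => ⟨hTd z hzE, fun l hl => by simp only [hTs l hl]⟩
  · refine ⟨?_, ?_, Or.inl hl₀, ?_, ?_, hTd⟩
    · rw [union_singleton, isOpen_iff_mem_nhds]
      rintro l (rfl | hl)
      · exact insert_mem_nhds_iff.2 hmem
      · exact mem_of_superset (hH.isOpen.mem_nhds hl) (subset_insert _ _)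
    · exact hH.isConnected.subset_closure subset_union_left
        (union_subset subset_closure (singleton_subset_iff.2 (frontier_subset_closure hstar.1)))
    · intro z hzE
      rw [hTs l₀ hl₀, hK.map_base z hzE]
    · rintro l (hl | rfl)
      · rw [hTs l hl]
        exact hK.vertically_injective l hl
      · rwa [hTl]
  · rintro l (hl | rfl)
    · rw [hTs l hl]
      exact ⟨hK₀ l hl, hK₁ l hl⟩
    · rw [hTl]
      exact ⟨hkc z₀ hz₀ hK₀, hkc z₁ hz₁ hK₁⟩
  · simp only [hF₀ hl₀, hF₁ hl₀, hH.map_base z₀ hz₀, hH.map_base z₁ hz₁]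
    rw [div_self hz]
    ring
  · simp only [hF₀ hl₀, hF₁ hl₀, hH.map_base z₀ hz₀, hH.map_base z₁ hz₁]
    exact div_self hz
  · intro l hl
    simp only [hF₀ hl, hF₁ hl]
    exact div_ne_zero (hH.sub_ne_zero hl hz₁ hz₀ hne.symm) hz
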